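/- **Bayesian confidence bound.** Let $d,K,n$ be natural numbers, $\mathcal A=\{1,\dots,K\}$ a set of actions, $\mathcal X$ a measurable space of contexts, $\phi:\mathcal X\to\mathbb R^d$ a measurable feature map, $\sigma>0$, and for each $a\in\mathcal A$ let $\mu_a\in\mathbb R^d$ and let $\Sigma_a\in\mathbb R^{d\times d}$ be symmetric positive definite. Consider random parameters $\theta_*=(\theta_{*,a})_{a\in\mathcal A}$ and a random data set $S=(X_i,A_i,R_i)_{i=1}^n$ with $X_i\in\mathcal X$, $A_i\in\mathcal A$, $R_i\in\mathbb R$, such that - the $\theta_{*,a}$ are independent with $\theta_{*,a}\sim\mathcal N(\mu_a,\Sigma_a)$; - $(X_i,A_i)_{i=1}^n$ is independent of $\theta_*$; - conditionally on $\theta_*$ and $(X_i,A_i)_{i=1}^n$, the rewards are independent with $R_i\sim\mathcal N(\phi(X_i)^\top\theta_{*,A_i},\sigma^2)$. For $a\in\mathcal A$ put $G_a=\sigma^{-2}\sum_{i=1}^n\mathbf 1\{A_i=a\}\phi(X_i)\phi(X_i)^\top$, $B_a=\sigma^{-2}\sum_{i=1}^n\mathbf 1\{A_i=a\}R_i\phi(X_i)$,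 $\hat\Sigma_a=(\Sigma_a^{-1}+G_a)^{-1}$ and $\hat\mu_a=\hat\Sigma_a(\Sigma_a^{-1}\mu_a+B_a)$. For positive definite $M$ write $\|v\|_M=\sqrt{v^\top Mv}$. Then for every $a\in\mathcal A$ and $\delta\in(0,1)$, almost surely, $$\mathbb P\Big(\forall x\in\mathcal X:\ |\phi(x)^\top\theta_{*,a}-\phi(x)^\top\hat\mu_a|\le\alpha(d,\delta)\,\|\phi(x)\|_{\hat\Sigma_a}\ \Big|\ S\Big)\ \ge\ 1-\delta,$$ where $\alpha(d,\delta)=\sqrt{d+2\sqrt{d\log\frac1\delta}+2\log\frac1\delta}$ and the conditional probability is taken under the regular conditional distribution of $\theta_*$ given $S$. -/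

import Mathlib

open MeasureTheory ProbabilityTheory

/-- The parameter space `ℝ^d` with its Euclidean structure. -/
abbrev Vec (d : ℕ) : Type := EuclideanSpace ℝ (Fin d)

/-- A logged data set `(xᵢ, aᵢ, rᵢ)`, `i ∈ [n]`, with contexts in `𝒳`, actions in `[K]` and real
rewards. -/
abbrev Sample (𝒳 : Type*) (K n : ℕ) : Type _ := Fin n → 𝒳 × Fin K × ℝ

/-- The weighted norm `‖x‖_M = √(xᵀ M x)`. -/
noncomputable def weightedNorm {d : ℕ} (M : Matrix (Fin d) (Fin d) ℝ) (x : Vec d) : ℝ :=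
  Real.sqrt (x.ofLp ⬝ᵥ M.mulVec x.ofLp)

/-- The mean reward `r(x, a; θ) = φ(x)ᵀ θ_a`. -/
noncomputable def meanReward {𝒳 : Type*} {d K : ℕ} (φ : 𝒳 → Vec d) (x : 𝒳) (a : Fin K)
    (θ : Fin K → Vec d) : ℝ :=
  (φ x).ofLp ⬝ᵥ (θ a).ofLp

/-- `G_a = σ⁻² ∑ᵢ 𝟙{aᵢ = a} φ(xᵢ) φ(xᵢ)ᵀ`. -/
noncomputable def gramMatrix {𝒳 : Type*} {d K n : ℕ} (φ : 𝒳 → Vec d) (σ : ℝ)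
    (s : Sample 𝒳 K n) (a : Fin K) : Matrix (Fin d) (Fin d) ℝ :=
  (σ ^ 2)⁻¹ • ∑ i, if (s i).2.1 = a then
    Matrix.vecMulVec (φ (s i).1).ofLp (φ (s i).1).ofLp else 0

/-- `B_a = σ⁻² ∑ᵢ 𝟙{aᵢ = a} rᵢ φ(xᵢ)`. -/
noncomputable def rewardVector {𝒳 : Type*} {d K n : ℕ} (φ : 𝒳 → Vec d) (σ : ℝ)
    (s : Sample 𝒳 K n) (a : Fin K) : Fin d → ℝ :=
  (σ ^ 2)⁻¹ • ∑ i, if (s i).2.1 = a then (s i).2.2 • (φ (s i).1).ofLp else 0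

/-- `Σ̂_a = (Σ_a⁻¹ + G_a)⁻¹`. -/
noncomputable def posteriorCov {𝒳 : Type*} {d K n : ℕ} (φ : 𝒳 → Vec d) (σ : ℝ)
    (C : Fin K → Matrix (Fin d) (Fin d) ℝ) (s : Sample 𝒳 K n) (a : Fin K) :
    Matrix (Fin d) (Fin d) ℝ :=
  ((C a)⁻¹ + gramMatrix φ σ s a)⁻¹

/-- `μ̂_a = Σ̂_a (Σ_a⁻¹ μ_a + B_a)`. -/
noncomputable def posteriorMean {𝒳 : Type*} {d K n : ℕ} (φ : 𝒳 → Vec d) (σ : ℝ)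
    (m : Fin K → Vec d) (C : Fin K → Matrix (Fin d) (Fin d) ℝ) (s : Sample 𝒳 K n) (a : Fin K) :
    Vec d :=
  WithLp.toLp 2 ((posteriorCov φ σ C s a).mulVec
    ((C a)⁻¹.mulVec (m a).ofLp + rewardVector φ σ s a))

/-- `α(d, δ) = √(d + 2 √(d log (1/δ)) + 2 log (1/δ))`. -/
noncomputable def confidenceRadius (d : ℕ) (δ : ℝ) : ℝ :=
  Real.sqrt (d + 2 * Real.sqrt (d * Real.log (1 / δ)) + 2 * Real.log (1 / δ))

/-- The data set as a random variable. -/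
def sampleOf {Ω 𝒳 : Type*} {K n : ℕ} (X : Fin n → Ω → 𝒳) (A : Fin n → Ω → Fin K)
    (R : Fin n → Ω → ℝ) (ω : Ω) : Sample 𝒳 K n :=
  fun i => (X i ω, A i ω, R i ω)

/-- The Bayesian linear-Gaussian contextual bandit with independent Gaussian priors on the action
parameters: `θ_a ∼ N(m_a, C_a)` independently over `a`, the contexts and actions are independent
of `θ`, and given `θ` and all contexts and actions the rewards are independent with
`Rᵢ ∼ N(φ(Xᵢ)ᵀ θ_{Aᵢ}, σ²)`. -/
structure IsGaussianBandit {Ω 𝒳 : Type*} [MeasurableSpace Ω] [MeasurableSpace 𝒳] {d K n : ℕ}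
    (P : Measure Ω) [IsProbabilityMeasure P] (φ : 𝒳 → Vec d) (σ : ℝ)
    (m : Fin K → Vec d) (C : Fin K → Matrix (Fin d) (Fin d) ℝ)
    (θ : Fin K → Ω → Vec d) (X : Fin n → Ω → 𝒳) (A : Fin n → Ω → Fin K)
    (R : Fin n → Ω → ℝ) : Prop where
  measurable_feature : Measurable φ
  measurable_param : ∀ a, Measurable (θ a)
  measurable_context : ∀ i, Measurable (X i)
  measurable_action : ∀ i, Measurable (A i)
  measurable_reward : ∀ i, Measurable (R i)
  param_law : ∀ a, P.map (θ a) = multivariateGaussian (m a) (C a)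
  param_indep : iIndepFun θ P
  design_indep : IndepFun (fun ω i => (X i ω, A i ω)) (fun ω a => θ a ω) P
  reward_law :
    ∀ᵐ z ∂(P.map fun ω => ((fun a => θ a ω), (fun i => (X i ω, A i ω)))),
      condDistrib (fun ω i => R i ω)
          (fun ω => ((fun a => θ a ω), (fun i => (X i ω, A i ω)))) P z =
        Measure.pi fun i =>
          gaussianReal (meanReward φ (z.2 i).1 (z.2 i).2 z.1) (Real.toNNReal (σ ^ 2))

/-! The posterior is never identified as a Gaussian; an ancillary-type pivot is used instead. Fix
the design and write `R_i = f_i · θ_{c_i} + ε_i` with noise variance `v = σ²`. The residual of the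
posterior normal equations, `(C_a⁻¹ + G_a) θ_a - (C_a⁻¹ m_a + B_a)`, then equals `U - C_a⁻¹ m_a`,
where `U = C_a⁻¹ θ_a - v⁻¹ ∑_{c_i = a} ε_i f_i`. Both `U` and the rewards are linear in the Gaussian
vector `(θ, ε)`, and they are uncorrelated: for `c_i = a` the prior contributes `C_a⁻¹ C_a f_i` and
the noise `-v⁻¹ v f_i`. Hence they are independent (`indepFun_designScore_designReward`). Moreover
`U` has mean `C_a⁻¹ m_a` and covariance equal to the precision `C_a⁻¹ + G_a` (`map_designScore`).

So the squared Mahalanobis distance from `θ_a` to the posterior mean is chi-square with `d` degrees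
of freedom and independent of the rewards. Integrating over the design makes it independent of the
whole data set (`measure_posteriorDistSq_le_inter`), which determines its conditional law given `S`.
A chi-square tail bound puts mass at least `1 - δ` on distance at most `α(d, δ)`, and Cauchy–Schwarz
in the metric of the posterior covariance turns this single event into the bound for all contexts
simultaneously. -/

/-! ### Chi-square tail bound -/

/-- This is `u ≤ sinh u` at `u = log w`. -/
theorem Real.log_le_half_sub_inv {w : ℝ} (hw : 1 ≤ w) : Real.log w ≤ (w - w⁻¹) / 2 := by
  have hw0 : 0 < w := by linarith
  have h := Real.self_le_sinh_iff.2 (Real.log_nonneg hw)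
  rwa [Real.sinh_log hw0] at h

theorem integral_exp_mul_sq_gaussianReal {l : ℝ} :
    ∫ x, Real.exp (l * x ^ 2) ∂(gaussianReal 0 1) = (√(1 - 2 * l))⁻¹ := by
  rw [integral_gaussianReal_eq_integral_smul (by norm_num)]
  have : ∀ x : ℝ, gaussianPDFReal 0 1 x • Real.exp (l * x ^ 2) =
      (√(2 * Real.pi))⁻¹ * Real.exp (-((1 - 2 * l) / 2) * x ^ 2) := by
    intro x
    simp only [gaussianPDFReal, NNReal.coe_one, mul_one, sub_zero, smul_eq_mul]
    rw [mul_assoc, ← Real.exp_add]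
    congr 2
    ring
  simp_rw [this]
  rw [integral_const_mul, integral_gaussian, ← Real.sqrt_inv, ← Real.sqrt_inv,
    ← Real.sqrt_mul (by positivity)]
  congr 1
  have := Real.pi_pos
  by_cases h : 1 - 2 * l = 0
  · simp [h]
  · field_simp

theorem integrable_exp_mul_sq_gaussianReal {l : ℝ} (hl : l < 1 / 2) :
    Integrable (fun x => Real.exp (l * x ^ 2)) (gaussianReal 0 1) := by
  -- The integral formula holds for every `l`, with both sides zero by convention when the integral
  -- diverges; a nonzero value therefore gives integrability.
  apply Integrable.of_integral_ne_zero
  rw [integral_exp_mul_sq_gaussianReal]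
  have : 0 < 1 - 2 * l := by linarith
  positivity

/-- Chernoff bound: the exponential moment of the squared norm factors over the coordinates. -/
theorem stdGaussian_real_norm_sq_ge_le {d : ℕ} {l : ℝ} (hl0 : 0 ≤ l) (hl : l < 1 / 2) (r : ℝ) :
    (stdGaussian (Vec d)).real {x | r ≤ ‖x‖ ^ 2} ≤
      Real.exp (-l * r) * (√(1 - 2 * l))⁻¹ ^ d := by
  have hmeas : Measurable (WithLp.toLp 2 : (Fin d → ℝ) → Vec d) := by fun_prop
  rw [← map_pi_eq_stdGaussian, map_measureReal_apply hmeas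
    (measurableSet_le measurable_const (by fun_prop))]
  have hset : WithLp.toLp 2 ⁻¹' {x : Vec d | r ≤ ‖x‖ ^ 2} =
      {x : Fin d → ℝ | r ≤ ∑ i, x i ^ 2} := by
    ext x
    simp [EuclideanSpace.real_norm_sq_eq]
  have hexp : ∀ x : Fin d → ℝ, Real.exp (l * ∑ i, x i ^ 2) = ∏ i, Real.exp (l * x i ^ 2) := by
    intro x
    rw [Finset.mul_sum, Real.exp_sum]
  rw [hset]
  refine (measure_ge_le_exp_mul_mgf r hl0 ?_).trans_eq ?_
  · simp_rw [hexp]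
    exact Integrable.fintype_prod (f := fun _ x => Real.exp (l * x ^ 2))
      fun _ => integrable_exp_mul_sq_gaussianReal hl
  · rw [mgf]
    simp_rw [hexp]
    rw [integral_fintype_prod_eq_prod (f := fun _ x => Real.exp (l * x ^ 2))]
    simp_rw [integral_exp_mul_sq_gaussianReal]
    simp

/-- This `l` makes `1 - 2l = 1/w` with `w = (√d + 2√t)/√d`. After `log w ≤ (w - w⁻¹)/2` the exponent
collapses to exactly `-t`, which explains the form of the threshold. -/
theorem exp_neg_mul_inv_sqrt_pow_le {d : ℕ} {t : ℝ} (hd : 0 < d) (ht : 0 < t) {l : ℝ}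
    (hl : l = √t / (√d + 2 * √t)) :
    Real.exp (-l * (d + 2 * √(d * t) + 2 * t)) * (√(1 - 2 * l))⁻¹ ^ d ≤ Real.exp (-t) := by
  have hd' : (0 : ℝ) < d := by exact_mod_cast hd
  have hp : 0 < √(d : ℝ) := Real.sqrt_pos.2 hd'
  have hq : 0 < √t := Real.sqrt_pos.2 ht
  have hpd : √(d : ℝ) ^ 2 = d := Real.sq_sqrt hd'.le
  have hqt : √t ^ 2 = t := Real.sq_sqrt ht.le
  have hu : 1 - 2 * l = √(d : ℝ) / (√d + 2 * √t) := by
    rw [hl]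
    field_simp
    ring
  have hw : 1 ≤ (√(d : ℝ) + 2 * √t) / √d := by
    rw [le_div_iff₀ hp]
    linarith
  have hinv : (√(1 - 2 * l))⁻¹ ^ d =
      Real.exp (d * (Real.log ((√(d : ℝ) + 2 * √t) / √d) / 2)) := by
    rw [← Real.sqrt_inv, hu, inv_div, Real.exp_nat_mul, ← Real.log_sqrt (by positivity),
      Real.exp_log (by positivity)]
  rw [hinv, ← Real.exp_add, Real.exp_le_exp]
  have hlog := mul_le_mul_of_nonneg_left (Real.log_le_half_sub_inv hw) (half_pos hd').le
  have key : -l * (d + 2 * √(d * t) + 2 * t) + d / 2 * (((√(d : ℝ) + 2 * √t) / √d -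
      ((√(d : ℝ) + 2 * √t) / √d)⁻¹) / 2) = -t := by
    rw [hl, Real.sqrt_mul hd'.le]
    generalize √(d : ℝ) = p at *
    generalize √t = q at *
    rw [← hpd, ← hqt]
    field_simp
    ring
  linarith

theorem stdGaussian_real_norm_sq_gt_le {d : ℕ} {t : ℝ} (ht : 0 < t) :
    (stdGaussian (Vec d)).real {x | d + 2 * √(d * t) + 2 * t < ‖x‖ ^ 2} ≤ Real.exp (-t) := by
  rcases Nat.eq_zero_or_pos d with rfl | hd
  -- For `d = 0` the choice of `l` would be the excluded value `1/2`, but the event is empty.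
  · have : {x : Vec 0 | ((0 : ℕ) : ℝ) + 2 * √((0 : ℕ) * t) + 2 * t < ‖x‖ ^ 2} = ∅ := by
      ext x
      simp [Subsingleton.elim x 0, ht.le]
    rw [this]
    simp [Real.exp_nonneg]
  · have hd' : (0 : ℝ) < d := by exact_mod_cast hd
    have hp : 0 < √(d : ℝ) := Real.sqrt_pos.2 hd'
    have hq : 0 < √t := Real.sqrt_pos.2 ht
    refine (measureReal_mono (s₂ := {x : Vec d | d + 2 * √(d * t) + 2 * t ≤ ‖x‖ ^ 2})
      (by intro x hx; simp only [Set.mem_ofPred_eq] at hx ⊢; exact hx.le)).trans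
      ((stdGaussian_real_norm_sq_ge_le (l := √t / (√d + 2 * √t)) (by positivity) ?_ _).trans
        (exp_neg_mul_inv_sqrt_pow_le hd ht rfl))
    rw [div_lt_div_iff₀ (by positivity) (by norm_num)]
    linarith

theorem stdGaussian_real_norm_sq_le_ge {d : ℕ} {δ : ℝ} (hδ : δ ∈ Set.Ioo (0 : ℝ) 1) :
    1 - δ ≤ (stdGaussian (Vec d)).real {x | ‖x‖ ^ 2 ≤ confidenceRadius d δ ^ 2} := by
  have ht : 0 < Real.log (1 / δ) := Real.log_pos (by rw [lt_div_iff₀ hδ.1]; linarith [hδ.2])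
  have h := stdGaussian_real_norm_sq_gt_le (d := d) ht
  have hexp : Real.exp (-Real.log (1 / δ)) = δ := by
    rw [one_div, Real.log_inv, neg_neg, Real.exp_log hδ.1]
  have hset : {x : Vec d | d + 2 * √(d * Real.log (1 / δ)) + 2 * Real.log (1 / δ) < ‖x‖ ^ 2} =
      {x | ‖x‖ ^ 2 ≤ confidenceRadius d δ ^ 2}ᶜ := by
    ext x
    rw [confidenceRadius, Real.sq_sqrt (by positivity)]
    simp
  rw [hexp, hset, probReal_compl_eq_one_sub (measurableSet_le (by fun_prop) measurable_const)] at h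
  linarith

/-! ### Cauchy–Schwarz, and covariances of linear forms -/

theorem Matrix.PosDef.dotProduct_sq_le {ι : Type*} [Fintype ι] [DecidableEq ι]
    {L : Matrix ι ι ℝ} (hL : L.PosDef) (x y : ι → ℝ) :
    (x ⬝ᵥ L⁻¹.mulVec y) ^ 2 ≤ (x ⬝ᵥ L⁻¹.mulVec x) * (y ⬝ᵥ L⁻¹.mulVec y) := by
  have hs := hL.inv.posSemidef
  have h := LinearMap.BilinForm.apply_sq_le_of_symm (Matrix.toBilin' L⁻¹)
    (fun z => by
      rw [Matrix.toBilin'_apply']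
      simpa using hs.dotProduct_mulVec_nonneg z)
    ⟨fun u v => by
      simp only [Matrix.toBilin'_apply', RingHom.id_apply]
      have ht : (L⁻¹).transpose = L⁻¹ := by simpa using hs.isHermitian.eq
      rw [dotProduct_comm, Matrix.dotProduct_mulVec, ← Matrix.mulVec_transpose, ht]⟩ x y
  simpa [Matrix.toBilin'_apply'] using h

theorem covariance_sum_pi {ι : Type*} [Fintype ι] {E : ι → Type*} [∀ i, MeasurableSpace (E i)]
    {μ : (i : ι) → Measure (E i)} [∀ i, IsProbabilityMeasure (μ i)] {f g : (i : ι) → E i → ℝ}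
    (hf : ∀ i, MemLp (f i) 2 (μ i)) (hg : ∀ i, MemLp (g i) 2 (μ i)) :
    cov[fun x => ∑ i, f i (x i), fun x => ∑ i, g i (x i); Measure.pi μ] =
      ∑ i, cov[f i, g i; μ i] := by
  classical
  have hf' : ∀ i, MemLp (fun x : (i : ι) → E i => f i (x i)) 2 (Measure.pi μ) := fun i =>
    (hf i).comp_measurePreserving (measurePreserving_eval μ i)
  have hg' : ∀ i, MemLp (fun x : (i : ι) → E i => g i (x i)) 2 (Measure.pi μ) := fun i =>
    (hg i).comp_measurePreserving (measurePreserving_eval μ i)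
  rw [covariance_fun_sum_fun_sum hf' hg']
  refine Finset.sum_congr rfl fun i _ => ?_
  rw [Finset.sum_eq_single i]
  · have h := (measurePreserving_eval μ i).map_eq
    conv_rhs => rw [← h]
    rw [covariance_map_fun]
    · rw [h]; exact (hf i).aestronglyMeasurable
    · rw [h]; exact (hg i).aestronglyMeasurable
    · exact (measurable_pi_apply i).aemeasurable
  · intro j _ hji
    have hind : iIndepFun (fun (i : ι) (x : (i : ι) → E i) => x i) (Measure.pi μ) :=
      iIndepFun_pi (X := fun i (x : E i) => x) fun i => aemeasurable_id
    refine IndepFun.covariance_eq_zero ?_ (hf' i) (hg' j)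
    refine (hind.indepFun hji.symm).comp₀ (φ := f i) (ψ := g j)
      (measurable_pi_apply i).aemeasurable (measurable_pi_apply j).aemeasurable ?_ ?_
    · rw [(measurePreserving_eval μ i).map_eq]; exact (hf i).aestronglyMeasurable.aemeasurable
    · rw [(measurePreserving_eval μ j).map_eq]; exact (hg j).aestronglyMeasurable.aemeasurable
  · simp

theorem covariance_add_prod {E F : Type*} [MeasurableSpace E] [MeasurableSpace F]
    {μ : Measure E} {ν : Measure F} [IsProbabilityMeasure μ] [IsProbabilityMeasure ν]
    {f f' : E → ℝ} {g g' : F → ℝ} (hf : MemLp f 2 μ) (hf' : MemLp f' 2 μ)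
    (hg : MemLp g 2 ν) (hg' : MemLp g' 2 ν) :
    cov[fun z => f z.1 + g z.2, fun z => f' z.1 + g' z.2; μ.prod ν] =
      cov[f, f'; μ] + cov[g, g'; ν] := by
  have h1 : cov[fun z : E × F => f z.1, fun z => f' z.1; μ.prod ν] = cov[f, f'; μ] := by
    have h := (measurePreserving_fst (μ := μ) (ν := ν)).map_eq
    conv_rhs => rw [← h]
    rw [covariance_map_fun (by rw [h]; exact hf.aestronglyMeasurable)
      (by rw [h]; exact hf'.aestronglyMeasurable) measurable_fst.aemeasurable]
  have h2 : cov[fun z : E × F => g z.2, fun z => g' z.2; μ.prod ν] = cov[g, g'; ν] := by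
    have h := (measurePreserving_snd (μ := μ) (ν := ν)).map_eq
    conv_rhs => rw [← h]
    rw [covariance_map_fun (by rw [h]; exact hg.aestronglyMeasurable)
      (by rw [h]; exact hg'.aestronglyMeasurable) measurable_snd.aemeasurable]
  have e1 : (fun z : E × F => f z.1 + g z.2) = (fun z => f z.1) + fun z => g z.2 := rfl
  have e2 : (fun z : E × F => f' z.1 + g' z.2) = (fun z => f' z.1) + fun z => g' z.2 := rfl
  rw [e1, e2, covariance_add_left (hf.comp_fst ν) (hg.comp_snd μ)
      ((hf'.comp_fst ν).add (hg'.comp_snd μ)),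
    covariance_add_right (hf.comp_fst ν) (hf'.comp_fst ν) (hg'.comp_snd μ),
    covariance_add_right (hg.comp_snd μ) (hf'.comp_fst ν) (hg'.comp_snd μ), h1, h2,
    covariance_fst_snd_prod hf hg', covariance_comm (fun z : E × F => g z.2),
    covariance_fst_snd_prod hf' hg]
  ring

theorem memLp_dotProduct_multivariateGaussian {d : ℕ} (m : Vec d) (C : Matrix (Fin d) (Fin d) ℝ)
    (u : Fin d → ℝ) : MemLp (fun x : Vec d => u ⬝ᵥ x.ofLp) 2 (multivariateGaussian m C) := by
  have h := IsGaussian.memLp_dual (multivariateGaussian m C)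
    (innerSL ℝ (WithLp.toLp 2 u : Vec d)) 2 (by simp)
  have e : (fun x : Vec d => u ⬝ᵥ x.ofLp) = innerSL ℝ (WithLp.toLp 2 u : Vec d) := by
    ext x
    simp [EuclideanSpace.inner_eq_star_dotProduct, dotProduct_comm]
  rwa [e]

theorem covariance_dotProduct_multivariateGaussian {d : ℕ} (m : Vec d)
    {C : Matrix (Fin d) (Fin d) ℝ} (hC : C.PosSemidef) (u v : Fin d → ℝ) :
    cov[fun x : Vec d => u ⬝ᵥ x.ofLp, fun x => v ⬝ᵥ x.ofLp; multivariateGaussian m C] =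
      u ⬝ᵥ C.mulVec v := by
  have h := covarianceBilin_multivariateGaussian (μ := m) hC (WithLp.toLp 2 u) (WithLp.toLp 2 v)
  rw [covarianceBilin_apply_eq_cov IsGaussian.memLp_two_id] at h
  simpa [EuclideanSpace.inner_eq_star_dotProduct, dotProduct_comm] using h

theorem integral_dotProduct_multivariateGaussian {d : ℕ} (m : Vec d)
    (C : Matrix (Fin d) (Fin d) ℝ) (u : Fin d → ℝ) :
    ∫ x : Vec d, u ⬝ᵥ x.ofLp ∂(multivariateGaussian m C) = u ⬝ᵥ m.ofLp := by
  have h := (innerSL ℝ (WithLp.toLp 2 u : Vec d)).integral_comp_id_comm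
    (IsGaussian.integrable_id (μ := multivariateGaussian m C))
  simpa [EuclideanSpace.inner_eq_star_dotProduct, dotProduct_comm] using h

open scoped MatrixOrder in
-- Write `y = m + S x` with `S = √C` and `x` standard Gaussian; since `S C⁻¹ S = 1`, the quadratic
-- form is `‖x‖²`.
theorem map_mahalanobis_multivariateGaussian {d : ℕ} (m : Vec d)
    {C : Matrix (Fin d) (Fin d) ℝ} (hC : C.PosDef) :
    (multivariateGaussian m C).map
        (fun y => (y - m).ofLp ⬝ᵥ C⁻¹.mulVec (y - m).ofLp) =
      (stdGaussian (Vec d)).map (fun x => ‖x‖ ^ 2) := by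
  have hmeas : Measurable fun y : Vec d => (y - m).ofLp ⬝ᵥ C⁻¹.mulVec (y - m).ofLp := by
    apply Continuous.measurable
    fun_prop
  rw [multivariateGaussian, Measure.map_map hmeas (by fun_prop)]
  congr 1
  ext x
  set S := CFC.sqrt C with hS
  have hSS : S * S = C := CFC.sqrt_mul_sqrt_self _ hC.posSemidef.nonneg
  have hST : S.transpose = S := by
    have := (CFC.sqrt_nonneg C).isSelfAdjoint
    rw [← Matrix.conjTranspose_eq_transpose_of_trivial, ← Matrix.star_eq_conjTranspose]
    exact this.star_eq
  have hdet : IsUnit S.det := by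
    have h := hC.det_pos.ne'
    rw [← hSS, Matrix.det_mul] at h
    exact isUnit_iff_ne_zero.2 (left_ne_zero_of_mul h)
  have hone : S * (C⁻¹ * S) = 1 := by
    rw [← hSS, Matrix.mul_inv_rev, Matrix.mul_assoc, Matrix.nonsing_inv_mul _ hdet, Matrix.mul_one,
      Matrix.mul_nonsing_inv _ hdet]
  simp only [Function.comp_apply, add_sub_cancel_left, Matrix.ofLp_toEuclideanCLM]
  have hvec : S.mulVec x.ofLp = Matrix.vecMul x.ofLp S := by rw [← Matrix.vecMul_transpose, hST]
  nth_rewrite 1 [hvec]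
  rw [← Matrix.dotProduct_mulVec, Matrix.mulVec_mulVec, Matrix.mulVec_mulVec, Matrix.mul_assoc, hone,
    Matrix.one_mulVec, EuclideanSpace.real_norm_sq_eq]
  simp [dotProduct, sq]

/-! ### Joint law of parameters and noise -/

/-- The joint law of independent Gaussian parameters `θ_b ∼ N(m_b, C_b)` and independent centred
Gaussian noise of variance `v`. -/
noncomputable def priorNoise {d K : ℕ} (n : ℕ) (m : Fin K → Vec d)
    (C : Fin K → Matrix (Fin d) (Fin d) ℝ) (v : NNReal) :
    Measure ((Fin K → Vec d) × (Fin n → ℝ)) :=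
  (Measure.pi fun b => multivariateGaussian (m b) (C b)).prod
    (Measure.pi fun _ => gaussianReal 0 v)

/-- The linear form `(θ, ε) ↦ ∑ u_b · θ_b + ∑ w_i ε_i`. -/
noncomputable def paramNoiseForm {d K n : ℕ} (u : Fin K → Fin d → ℝ) (w : Fin n → ℝ)
    (z : (Fin K → Vec d) × (Fin n → ℝ)) : ℝ :=
  ∑ b, u b ⬝ᵥ (z.1 b).ofLp + ∑ i, w i * z.2 i

instance {d K : ℕ} (n : ℕ) (m : Fin K → Vec d) (C : Fin K → Matrix (Fin d) (Fin d) ℝ)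
    (v : NNReal) : IsProbabilityMeasure (priorNoise n m C v) := by
  unfold priorNoise
  infer_instance

theorem isGaussian_pi {ι E : Type*} [Fintype ι] [NormedAddCommGroup E] [NormedSpace ℝ E]
    [MeasurableSpace E] [BorelSpace E] [SecondCountableTopology E] [CompleteSpace E]
    (μ : ι → Measure E) [∀ i, IsGaussian (μ i)] : IsGaussian (Measure.pi μ) := by
  have h := (iIndepFun_pi (μ := μ) (X := fun _ (x : E) => x)
    fun i => aemeasurable_id).hasGaussianLaw fun i => by
      refine ⟨?_⟩
      rw [(measurePreserving_eval μ i).map_eq]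
      infer_instance
  simpa using h.isGaussian_map

instance {d K : ℕ} (n : ℕ) (m : Fin K → Vec d) (C : Fin K → Matrix (Fin d) (Fin d) ℝ)
    (v : NNReal) : IsGaussian (priorNoise n m C v) := by
  have := isGaussian_pi fun b => multivariateGaussian (m b) (C b)
  have := isGaussian_pi fun _ : Fin n => gaussianReal 0 v
  unfold priorNoise
  infer_instance

theorem memLp_mul_gaussianReal (v : NNReal) (w : ℝ) :
    MemLp (fun x : ℝ => w * x) 2 (gaussianReal 0 v) :=
  (memLp_id_gaussianReal 2).const_mul w

section PriorNoise

variable {d K n : ℕ} (m : Fin K → Vec d) {C : Fin K → Matrix (Fin d) (Fin d) ℝ} (v : NNReal)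

theorem memLp_sum_dotProduct (u : Fin K → Fin d → ℝ) :
    MemLp (fun θ : Fin K → Vec d => ∑ b, u b ⬝ᵥ (θ b).ofLp) 2
      (Measure.pi fun b => multivariateGaussian (m b) (C b)) :=
  memLp_finsetSum _ fun b _ => (memLp_dotProduct_multivariateGaussian (m b) (C b)
    (u b)).comp_measurePreserving
      (measurePreserving_eval (fun b => multivariateGaussian (m b) (C b)) b)

theorem memLp_sum_mul (w : Fin n → ℝ) :
    MemLp (fun ε : Fin n → ℝ => ∑ i, w i * ε i) 2 (Measure.pi fun _ => gaussianReal 0 v) :=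
  memLp_finsetSum _ fun i _ => (memLp_mul_gaussianReal v (w i)).comp_measurePreserving
      (measurePreserving_eval (fun _ => gaussianReal 0 v) i)

theorem covariance_paramNoiseForm (hC : ∀ b, (C b).PosSemidef) (u u' : Fin K → Fin d → ℝ)
    (w w' : Fin n → ℝ) :
    cov[paramNoiseForm u w, paramNoiseForm u' w'; priorNoise n m C v] =
      ∑ b, u b ⬝ᵥ (C b).mulVec (u' b) + ∑ i, w i * w' i * v := by
  unfold paramNoiseForm priorNoise
  refine (covariance_add_prod (memLp_sum_dotProduct (C := C) m u)
    (memLp_sum_dotProduct (C := C) m u') (memLp_sum_mul v w) (memLp_sum_mul v w')).trans ?_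
  congr 1
  · refine (covariance_sum_pi (μ := fun b => multivariateGaussian (m b) (C b))
      (f := fun b (x : Vec d) => u b ⬝ᵥ x.ofLp) (g := fun b (x : Vec d) => u' b ⬝ᵥ x.ofLp)
      (fun b => memLp_dotProduct_multivariateGaussian _ _ _)
      (fun b => memLp_dotProduct_multivariateGaussian _ _ _)).trans ?_
    exact Finset.sum_congr rfl fun b _ =>
      covariance_dotProduct_multivariateGaussian (m b) (hC b) _ _
  · refine (covariance_sum_pi (μ := fun _ : Fin n => gaussianReal 0 v)
      (f := fun i (x : ℝ) => w i * x) (g := fun i (x : ℝ) => w' i * x)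
      (fun i => memLp_mul_gaussianReal v _) (fun i => memLp_mul_gaussianReal v _)).trans ?_
    refine Finset.sum_congr rfl fun i _ => ?_
    rw [covariance_const_mul_left, covariance_const_mul_right,
      covariance_self (by fun_prop), variance_fun_id_gaussianReal, mul_assoc]

theorem integral_paramNoiseForm (u : Fin K → Fin d → ℝ) (w : Fin n → ℝ) :
    ∫ z, paramNoiseForm u w z ∂(priorNoise n m C v) = ∑ b, u b ⬝ᵥ (m b).ofLp := by
  unfold paramNoiseForm priorNoise
  have h1 := ((memLp_sum_dotProduct (C := C) m u).comp_fst
    (Measure.pi fun _ : Fin n => gaussianReal 0 v)).integrable (by norm_num)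
  have h2 := ((memLp_sum_mul v w).comp_snd
    (Measure.pi fun b => multivariateGaussian (m b) (C b))).integrable (by norm_num)
  rw [integral_add h1 h2, integral_fun_fst (f := fun θ : Fin K → Vec d => ∑ b, u b ⬝ᵥ (θ b).ofLp),
    integral_fun_snd (f := fun ε : Fin n → ℝ => ∑ i, w i * ε i), integral_finsetSum,
    integral_finsetSum]
  · have e1 : ∀ b, ∫ θ : Fin K → Vec d, u b ⬝ᵥ (θ b).ofLp
        ∂(Measure.pi fun b => multivariateGaussian (m b) (C b)) = u b ⬝ᵥ (m b).ofLp := by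
      intro b
      rw [integral_comp_eval (μ := fun b => multivariateGaussian (m b) (C b)) (i := b)
        (f := fun x => u b ⬝ᵥ x.ofLp)
        (memLp_dotProduct_multivariateGaussian _ _ _).aestronglyMeasurable,
        integral_dotProduct_multivariateGaussian]
    have e2 : ∀ i, ∫ ε : Fin n → ℝ, w i * ε i ∂(Measure.pi fun _ => gaussianReal 0 v) = 0 := by
      intro i
      rw [integral_comp_eval (μ := fun _ => gaussianReal 0 v) (i := i) (f := fun x => w i * x)
        (by fun_prop), integral_const_mul]
      simp
    simp [e1, e2]
  · exact fun i _ => ((memLp_mul_gaussianReal v (w i)).comp_measurePreserving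
      (measurePreserving_eval (fun _ => gaussianReal 0 v) i)).integrable (by norm_num)
  · exact fun b _ => ((memLp_dotProduct_multivariateGaussian (m b) (C b)
    (u b)).comp_measurePreserving (measurePreserving_eval
      (fun b => multivariateGaussian (m b) (C b)) b)).integrable (by norm_num)

end PriorNoise

/-! ### The pivot for a fixed design -/

section FixedDesign

variable {d K n : ℕ}

/-- The precision matrix `C_a⁻¹ + v⁻¹ ∑ᵢ 𝟙{cᵢ = a} fᵢ fᵢᵀ`. -/
noncomputable def designPrecision (C : Fin K → Matrix (Fin d) (Fin d) ℝ) (v : NNReal)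
    (f : Fin n → Fin d → ℝ) (c : Fin n → Fin K) (a : Fin K) : Matrix (Fin d) (Fin d) ℝ :=
  (C a)⁻¹ + (v : ℝ)⁻¹ • ∑ i, if c i = a then Matrix.vecMulVec (f i) (f i) else 0

/-- The score `C_a⁻¹ θ_a - v⁻¹ ∑ᵢ 𝟙{cᵢ = a} εᵢ fᵢ`. -/
noncomputable def designScore (C : Fin K → Matrix (Fin d) (Fin d) ℝ) (v : NNReal)
    (f : Fin n → Fin d → ℝ) (c : Fin n → Fin K) (a : Fin K)
    (z : (Fin K → Vec d) × (Fin n → ℝ)) : Vec d :=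
  WithLp.toLp 2 ((C a)⁻¹.mulVec (z.1 a).ofLp -
    (v : ℝ)⁻¹ • ∑ i, if c i = a then z.2 i • f i else 0)

/-- The rewards `fᵢ · θ_{cᵢ} + εᵢ`. -/
noncomputable def designReward (f : Fin n → Fin d → ℝ) (c : Fin n → Fin K)
    (z : (Fin K → Vec d) × (Fin n → ℝ)) : Fin n → ℝ :=
  fun i => f i ⬝ᵥ (z.1 (c i)).ofLp + z.2 i

variable {C : Fin K → Matrix (Fin d) (Fin d) ℝ} (v : NNReal)
  (f : Fin n → Fin d → ℝ) (c : Fin n → Fin K) (a : Fin K)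

theorem posDef_designPrecision (hC : (C a).PosDef) : (designPrecision C v f c a).PosDef := by
  refine hC.inv.add_posSemidef (Matrix.PosSemidef.smul ?_ (by positivity))
  refine Matrix.posSemidef_sum _ fun i _ => ?_
  split_ifs
  · simpa using Matrix.posSemidef_vecMulVec_self_star (f i)
  · exact Matrix.PosSemidef.zero

theorem dotProduct_designPrecision (t : Fin d → ℝ) :
    t ⬝ᵥ (designPrecision C v f c a).mulVec t =
      t ⬝ᵥ (C a)⁻¹.mulVec t + ∑ i, if c i = a then (v : ℝ)⁻¹ * (f i ⬝ᵥ t) ^ 2 else 0 := by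
  rw [designPrecision, Matrix.add_mulVec, dotProduct_add, Matrix.smul_mulVec, dotProduct_smul,
    Matrix.sum_mulVec, dotProduct_sum, smul_eq_mul, Finset.mul_sum]
  congr 1
  refine Finset.sum_congr rfl fun i _ => ?_
  split_ifs
  · rw [Matrix.vecMulVec_mulVec, dotProduct_smul, dotProduct_comm t,
      op_smul_eq_smul, smul_eq_mul, sq]
  · simp

theorem measurable_designReward : Measurable (designReward (d := d) f c) := by
  unfold designReward
  apply Continuous.measurable
  fun_prop

theorem designScore_apply (z : (Fin K → Vec d) × (Fin n → ℝ)) (k : Fin d) :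
    designScore C v f c a z k = (C a)⁻¹.mulVec (z.1 a).ofLp k -
      (v : ℝ)⁻¹ * ∑ i, if c i = a then z.2 i * f i k else 0 := by
  simp only [designScore, Pi.sub_apply, Pi.smul_apply, Finset.sum_apply, smul_eq_mul]
  congr 2
  refine Finset.sum_congr rfl fun i _ => ?_
  split_ifs <;> simp

theorem hasGaussianLaw_designScore_designReward (m : Fin K → Vec d) :
    HasGaussianLaw (fun z => (designScore C v f c a z, designReward f c z))
      (priorNoise n m C v) := by
  let L : ((Fin K → Vec d) × (Fin n → ℝ)) →ₗ[ℝ] Vec d × (Fin n → ℝ) :=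
    { toFun := fun z => (designScore C v f c a z, designReward f c z)
      map_add' := by
        intro x y
        ext i
        · have hsum : ∀ j, (if c j = a then (x + y).2 j * f j i else 0) =
              (if c j = a then x.2 j * f j i else 0) + if c j = a then y.2 j * f j i else 0 := by
            intro j
            split_ifs <;> simp [add_mul]
          simp only [Prod.fst_add, PiLp.add_apply, designScore_apply, hsum, Finset.sum_add_distrib]
          simp only [Pi.add_apply, WithLp.ofLp_add, Matrix.mulVec_add]
          ring
        · simp [designReward]
          ring
      map_smul' := by
        intro r x
        ext i
        · have hsum : ∀ j, (if c j = a then (r • x).2 j * f j i else 0) =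
              r * if c j = a then x.2 j * f j i else 0 := by
            intro j
            split_ifs <;> simp [mul_assoc]
          simp only [Prod.smul_fst, PiLp.smul_apply, designScore_apply, hsum, ← Finset.mul_sum]
          simp only [Pi.smul_apply, WithLp.ofLp_smul, Matrix.mulVec_smul,
            smul_eq_mul, RingHom.id_apply]
          ring
        · simp [designReward]
          ring }
  exact (IsGaussian.hasGaussianLaw_id (μ := priorNoise n m C v)).map
    (LinearMap.toContinuousLinearMap L)

/-- Scalar projections of the score become linear forms in `(θ, ε)`, so their means and covariances
can be read off from `integral_paramNoiseForm` and `covariance_paramNoiseForm`. -/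
theorem inner_designScore (hC : (C a).PosDef) (t : Vec d) (z : (Fin K → Vec d) × (Fin n → ℝ)) :
    inner ℝ t (designScore C v f c a z) =
      paramNoiseForm (Pi.single a ((C a)⁻¹.mulVec t.ofLp))
        (fun i => if c i = a then -((v : ℝ)⁻¹ * (f i ⬝ᵥ t.ofLp)) else 0) z := by
  have hsymm : ((C a)⁻¹).transpose = (C a)⁻¹ := by simpa using hC.inv.isHermitian.eq
  have h1 : ∑ b, (Pi.single a ((C a)⁻¹.mulVec t.ofLp) : Fin K → Fin d → ℝ) b ⬝ᵥ (z.1 b).ofLp =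
      t.ofLp ⬝ᵥ (C a)⁻¹.mulVec (z.1 a).ofLp := by
    rw [Finset.sum_eq_single a (fun b _ hb => by simp [hb]) (by simp), Pi.single_eq_same,
      Matrix.dotProduct_mulVec, ← Matrix.mulVec_transpose, hsymm]
  rw [EuclideanSpace.inner_eq_star_dotProduct, paramNoiseForm, h1, designScore]
  simp only [star_trivial]
  rw [dotProduct_comm, dotProduct_sub, sub_eq_add_neg, dotProduct_smul, dotProduct_sum,
    smul_eq_mul, Finset.mul_sum, ← Finset.sum_neg_distrib]
  congr 1
  refine Finset.sum_congr rfl fun i _ => ?_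
  split_ifs
  · rw [dotProduct_smul, dotProduct_comm t.ofLp, smul_eq_mul]
    ring
  · simp

theorem designReward_eq (i : Fin n) (z : (Fin K → Vec d) × (Fin n → ℝ)) :
    designReward f c z i = paramNoiseForm (Pi.single (c i) (f i)) (Pi.single i 1) z := by
  rw [paramNoiseForm, Finset.sum_eq_single (c i) (fun b _ hb => by simp [hb]) (by simp),
    Finset.sum_eq_single i (fun b _ hb => by simp [hb]) (by simp)]
  simp [designReward]

theorem indepFun_designScore_designReward (hC : ∀ b, (C b).PosDef) (hv : v ≠ 0)
    (m : Fin K → Vec d) :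
    IndepFun (designScore C v f c a) (designReward f c) (priorNoise n m C v) := by
  have h := (hasGaussianLaw_designScore_designReward v f c a m (C := C))
  -- The rewards move to Euclidean space, where joint Gaussianity reduces independence to vanishing
  -- covariances of inner products.
  have hE : HasGaussianLaw (fun z => (designScore C v f c a z,
      (WithLp.toLp 2 (designReward f c z) : EuclideanSpace ℝ (Fin n)))) (priorNoise n m C v) :=
    h.map_equiv (.prodCongr (.refl ℝ _) (PiLp.continuousLinearEquiv 2 ℝ (fun _ => ℝ)).symm)
  refine (HasGaussianLaw.indepFun_of_covariance_inner hE fun t s => ?_).comp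
    (φ := id) (ψ := WithLp.ofLp) measurable_id (by fun_prop)
  have hr : ∀ z : (Fin K → Vec d) × (Fin n → ℝ),
      inner ℝ s (WithLp.toLp 2 (designReward f c z)) =
        ∑ i, s i * paramNoiseForm (Pi.single (c i) (f i)) (Pi.single i 1) z := by
    intro z
    simp [PiLp.inner_apply, designReward_eq, mul_comm]
  have hmem : ∀ i, MemLp (fun z => s i *
      paramNoiseForm (Pi.single (c i) (f i)) (Pi.single i 1) z) 2 (priorNoise n m C v) := by
    intro i
    simp_rw [← designReward_eq]
    exact (h.snd.eval i).memLp_two.const_mul _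
  have hmem' : MemLp (fun z => inner ℝ t (designScore C v f c a z)) 2 (priorNoise n m C v) :=
    (h.fst.map (innerSL ℝ t)).memLp_two
  simp_rw [hr]
  rw [covariance_fun_sum_right hmem hmem']
  refine Finset.sum_eq_zero fun i _ => ?_
  rw [covariance_const_mul_right]
  simp_rw [inner_designScore v f c a (hC a)]
  refine mul_eq_zero_of_right _ ((covariance_paramNoiseForm m v (fun b => (hC b).posSemidef)
    _ _ _ _).trans ?_)
  rw [Finset.sum_eq_single a (fun b _ hb => by simp [hb]) (by simp),
    Finset.sum_eq_single i (fun b _ hb => by simp [hb]) (by simp), Pi.single_eq_same,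
    Pi.single_eq_same]
  have hv' : (v : ℝ) ≠ 0 := by exact_mod_cast hv
  have hsymm : ((C a)⁻¹).transpose = (C a)⁻¹ := by simpa using (hC a).inv.isHermitian.eq
  split_ifs with hca
  -- The cancellation behind the theorem: `C_a⁻¹ C_a = 1` leaves `t · f_i` from the prior, and the
  -- noise contributes `-v⁻¹ (f_i · t) v`.
  · subst hca
    rw [Pi.single_eq_same, ← Matrix.vecMul_transpose, hsymm, ← Matrix.dotProduct_mulVec,
      Matrix.mulVec_mulVec, Matrix.nonsing_inv_mul _ (hC (c i)).det_pos.ne'.isUnit,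
      Matrix.one_mulVec, dotProduct_comm]
    field_simp
    ring
  · rw [Pi.single_eq_of_ne (Ne.symm hca)]
    simp

/-- The variance along `t` is `t · C_a⁻¹ C_a C_a⁻¹ t` from the prior plus `v⁻¹ ∑ (f_i · t)²` over
`c_i = a` from the noise: the quadratic form of the precision matrix. Characteristic functions then
identify the law. -/
theorem map_designScore (hC : ∀ b, (C b).PosDef) (hv : v ≠ 0) (m : Fin K → Vec d) :
    (priorNoise n m C v).map (designScore C v f c a) =
      multivariateGaussian (WithLp.toLp 2 ((C a)⁻¹.mulVec (m a).ofLp))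
        (designPrecision C v f c a) := by
  have h := (hasGaussianLaw_designScore_designReward v f c a m (C := C)).fst
  have := h.isGaussian_map
  have hv' : (v : ℝ) ≠ 0 := by exact_mod_cast hv
  have hsymm : ((C a)⁻¹).transpose = (C a)⁻¹ := by simpa using (hC a).inv.isHermitian.eq
  apply Measure.ext_of_charFun
  ext t
  rw [h.charFun_map_eq, charFun_multivariateGaussian
    (posDef_designPrecision v f c a (hC a)).posSemidef, dotProduct_designPrecision,
    ← covariance_self (X := fun z => inner ℝ t (designScore C v f c a z))
      ((h.map (innerSL ℝ t)).aemeasurable)]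
  simp_rw [inner_designScore v f c a (hC a)]
  rw [integral_paramNoiseForm, covariance_paramNoiseForm m v (fun b => (hC b).posSemidef)]
  rw [Finset.sum_eq_single a (fun b _ hb => by simp [hb]) (by simp),
    Finset.sum_eq_single a (fun b _ hb => by simp [hb]) (by simp), Pi.single_eq_same,
    Matrix.mulVec_mulVec, Matrix.mul_nonsing_inv _ (hC a).det_pos.ne'.isUnit, Matrix.one_mulVec]
  have e1 : (C a)⁻¹.mulVec t.ofLp ⬝ᵥ (m a).ofLp =
      inner ℝ t (WithLp.toLp 2 ((C a)⁻¹.mulVec (m a).ofLp) : Vec d) := by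
    rw [EuclideanSpace.inner_eq_star_dotProduct, star_trivial, dotProduct_comm _ t.ofLp,
      Matrix.dotProduct_mulVec, ← Matrix.mulVec_transpose, hsymm]
  have e2 : ∀ i, (if c i = a then -((v : ℝ)⁻¹ * (f i ⬝ᵥ t.ofLp)) else 0) *
      (if c i = a then -((v : ℝ)⁻¹ * (f i ⬝ᵥ t.ofLp)) else 0) * v =
        if c i = a then (v : ℝ)⁻¹ * (f i ⬝ᵥ t.ofLp) ^ 2 else 0 := by
    intro i
    split_ifs
    · field_simp
    · simp
  simp_rw [e1, e2, dotProduct_comm ((C a)⁻¹.mulVec t.ofLp)]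

theorem priorNoise_mahalanobis_inter (hC : ∀ b, (C b).PosDef) (hv : v ≠ 0) (m : Fin K → Vec d)
    (r : ℝ) {B : Set (Fin n → ℝ)} (hB : MeasurableSet B) :
    priorNoise n m C v {z |
        (designScore C v f c a z - WithLp.toLp 2 ((C a)⁻¹.mulVec (m a).ofLp)).ofLp ⬝ᵥ
          (designPrecision C v f c a)⁻¹.mulVec
            (designScore C v f c a z - WithLp.toLp 2 ((C a)⁻¹.mulVec (m a).ofLp)).ofLp ≤ r ∧
        designReward f c z ∈ B} =
      stdGaussian (Vec d) {x | ‖x‖ ^ 2 ≤ r} * priorNoise n m C v {z | designReward f c z ∈ B} := by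
  set μ : Vec d := WithLp.toLp 2 ((C a)⁻¹.mulVec (m a).ofLp)
  set L := designPrecision C v f c a
  let q : Vec d → ℝ := fun y => (y - μ).ofLp ⬝ᵥ L⁻¹.mulVec (y - μ).ofLp
  have hq : Measurable q := by
    apply Continuous.measurable
    fun_prop
  have hi := (indepFun_designScore_designReward v f c a hC hv m).comp hq measurable_id
  have hlaw : (priorNoise n m C v).map (q ∘ designScore C v f c a) =
      (stdGaussian (Vec d)).map fun x => ‖x‖ ^ 2 := by
    rw [← map_mahalanobis_multivariateGaussian μ (posDef_designPrecision v f c a (hC a)),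
      ← map_designScore v f c a hC hv m, AEMeasurable.map_map_of_aemeasurable hq.aemeasurable
        (hasGaussianLaw_designScore_designReward v f c a m (C := C)).fst.aemeasurable]
  have hprod := hi.measure_inter_preimage_eq_mul (Set.Iic r) B measurableSet_Iic hB
  have hfirst : priorNoise n m C v ((q ∘ designScore C v f c a) ⁻¹' Set.Iic r) =
      stdGaussian (Vec d) {x | ‖x‖ ^ 2 ≤ r} := by
    rw [← Measure.map_apply_of_aemeasurable _ measurableSet_Iic, hlaw,
      Measure.map_apply (by fun_prop) measurableSet_Iic]
    · rfl
    · exact hq.comp_aemeasurable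
        (hasGaussianLaw_designScore_designReward v f c a m (C := C)).fst.aemeasurable
  rw [hfirst] at hprod
  exact hprod

end FixedDesign

/-! ### From the pivot to the posterior mean and covariance -/

section Posterior

variable {𝒳 : Type*} {d K n : ℕ} (φ : 𝒳 → Vec d) (σ : ℝ) (m : Fin K → Vec d)
  (C : Fin K → Matrix (Fin d) (Fin d) ℝ)

/-- The residual `(C_a⁻¹ + G_a) ϑ_a - (C_a⁻¹ m_a + B_a)` of the posterior normal equations. -/
noncomputable def posteriorScore (s : Sample 𝒳 K n) (a : Fin K) (ϑ : Fin K → Vec d) :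
    Fin d → ℝ :=
  ((C a)⁻¹ + gramMatrix φ σ s a).mulVec (ϑ a).ofLp -
    ((C a)⁻¹.mulVec (m a).ofLp + rewardVector φ σ s a)

/-- The squared Mahalanobis distance of `ϑ_a` from the posterior mean. -/
noncomputable def posteriorDistSq (s : Sample 𝒳 K n) (a : Fin K) (ϑ : Fin K → Vec d) : ℝ :=
  posteriorScore φ σ m C s a ϑ ⬝ᵥ (posteriorCov φ σ C s a).mulVec (posteriorScore φ σ m C s a ϑ)

/-- The data set with a given design and given rewards. -/
def sampleOfDesign (D : Fin n → 𝒳 × Fin K) (r : Fin n → ℝ) : Sample 𝒳 K n :=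
  fun i => ((D i).1, (D i).2, r i)

variable {C}

theorem posDef_posteriorPrecision (s : Sample 𝒳 K n) (a : Fin K) (hC : (C a).PosDef) :
    ((C a)⁻¹ + gramMatrix φ σ s a).PosDef := by
  refine hC.inv.add_posSemidef (Matrix.PosSemidef.smul ?_ (by positivity))
  refine Matrix.posSemidef_sum _ fun i _ => ?_
  split_ifs
  · simpa using Matrix.posSemidef_vecMulVec_self_star (φ (s i).1).ofLp
  · exact Matrix.PosSemidef.zero

/-- With `u` the posterior score, the difference of mean rewards is `φ(x) · Σ̂_a u`. Cauchy–Schwarz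
for the form `Σ̂_a` separates `φ(x)` from `u`, so one bound on `u` serves every `x`. -/
theorem abs_meanReward_sub_le (s : Sample 𝒳 K n) (a : Fin K) (hC : (C a).PosDef)
    {ϑ : Fin K → Vec d} {δ : ℝ}
    (h : posteriorDistSq φ σ m C s a ϑ ≤ confidenceRadius d δ ^ 2) (x : 𝒳) :
    |meanReward φ x a ϑ - meanReward φ x a (posteriorMean φ σ m C s)| ≤
      confidenceRadius d δ * weightedNorm (posteriorCov φ σ C s a) (φ x) := by
  have hL := posDef_posteriorPrecision φ σ s a hC
  have hdiff : meanReward φ x a ϑ - meanReward φ x a (posteriorMean φ σ m C s) =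
      (φ x).ofLp ⬝ᵥ (posteriorCov φ σ C s a).mulVec (posteriorScore φ σ m C s a ϑ) := by
    rw [meanReward, meanReward, ← dotProduct_sub, posteriorScore, Matrix.mulVec_sub,
      posteriorMean, posteriorCov, Matrix.mulVec_mulVec,
      Matrix.nonsing_inv_mul _ hL.det_pos.ne'.isUnit, Matrix.one_mulVec]
  have hcs := hL.dotProduct_sq_le (φ x).ofLp (posteriorScore φ σ m C s a ϑ)
  have hpos : 0 ≤ (φ x).ofLp ⬝ᵥ (posteriorCov φ σ C s a).mulVec (φ x).ofLp := by
    simpa [posteriorCov] using hL.inv.posSemidef.dotProduct_mulVec_nonneg (φ x).ofLp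
  have hr : 0 ≤ confidenceRadius d δ := Real.sqrt_nonneg _
  rw [hdiff]
  refine abs_le_of_sq_le_sq ?_ (mul_nonneg hr (Real.sqrt_nonneg _))
  rw [mul_pow, weightedNorm, Real.sq_sqrt hpos, mul_comm]
  exact hcs.trans (mul_le_mul_of_nonneg_left h hpos)

theorem gramMatrix_sampleOfDesign (D : Fin n → 𝒳 × Fin K) (r : Fin n → ℝ) (a : Fin K) :
    gramMatrix φ σ (sampleOfDesign D r) a = (σ ^ 2)⁻¹ • ∑ i, if (D i).2 = a then
      Matrix.vecMulVec (φ (D i).1).ofLp (φ (D i).1).ofLp else 0 := rfl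

theorem rewardVector_sampleOfDesign (D : Fin n → 𝒳 × Fin K) (r : Fin n → ℝ) (a : Fin K) :
    rewardVector φ σ (sampleOfDesign D r) a = (σ ^ 2)⁻¹ • ∑ i, if (D i).2 = a then
      r i • (φ (D i).1).ofLp else 0 := rfl

theorem posteriorCov_sampleOfDesign (D : Fin n → 𝒳 × Fin K) (r : Fin n → ℝ) (a : Fin K) :
    posteriorCov φ σ C (sampleOfDesign D r) a =
      (designPrecision C (σ ^ 2).toNNReal (fun i => (φ (D i).1).ofLp) (fun i => (D i).2) a)⁻¹ := by
  rw [posteriorCov, designPrecision, gramMatrix_sampleOfDesign,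
    Real.coe_toNNReal _ (sq_nonneg σ)]

/-- For `c_i = a`, `f_i f_iᵀ θ_a = (r_i - ε_i) f_i`, so the reward terms cancel and only the noise
survives. -/
theorem posteriorScore_sampleOfDesign (D : Fin n → 𝒳 × Fin K) (a : Fin K)
    (z : (Fin K → Vec d) × (Fin n → ℝ)) :
    posteriorScore φ σ m C (sampleOfDesign D
        (designReward (fun i => (φ (D i).1).ofLp) (fun i => (D i).2) z)) a z.1 =
      (designScore C (σ ^ 2).toNNReal (fun i => (φ (D i).1).ofLp) (fun i => (D i).2) a z -
        WithLp.toLp 2 ((C a)⁻¹.mulVec (m a).ofLp)).ofLp := by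
  have hsum : (∑ i, if (D i).2 = a then Matrix.vecMulVec (φ (D i).1).ofLp (φ (D i).1).ofLp
        else 0 : Matrix (Fin d) (Fin d) ℝ).mulVec (z.1 a).ofLp =
      (∑ i, if (D i).2 = a then
        designReward (fun i => (φ (D i).1).ofLp) (fun i => (D i).2) z i • (φ (D i).1).ofLp else 0) -
      ∑ i, if (D i).2 = a then z.2 i • (φ (D i).1).ofLp else 0 := by
    rw [Matrix.sum_mulVec, ← Finset.sum_sub_distrib]
    refine Finset.sum_congr rfl fun i _ => ?_
    split_ifs with h
    · rw [Matrix.vecMulVec_mulVec, op_smul_eq_smul, ← sub_smul, designReward, h, add_sub_cancel_right]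
    · simp
  simp only [posteriorScore, gramMatrix_sampleOfDesign, rewardVector_sampleOfDesign, designScore,
    Real.coe_toNNReal _ (sq_nonneg σ), WithLp.ofLp_sub, Matrix.add_mulVec, Matrix.smul_mulVec]
  rw [hsum, smul_sub]
  abel

theorem priorNoise_posteriorDistSq_inter (hσ : 0 < σ) (hC : ∀ b, (C b).PosDef)
    (D : Fin n → 𝒳 × Fin K) (a : Fin K) (r : ℝ) {B : Set (Fin n → ℝ)} (hB : MeasurableSet B) :
    priorNoise n m C (σ ^ 2).toNNReal {z |
        posteriorDistSq φ σ m C (sampleOfDesign D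
          (designReward (fun i => (φ (D i).1).ofLp) (fun i => (D i).2) z)) a z.1 ≤ r ∧
        designReward (fun i => (φ (D i).1).ofLp) (fun i => (D i).2) z ∈ B} =
      stdGaussian (Vec d) {x | ‖x‖ ^ 2 ≤ r} * priorNoise n m C (σ ^ 2).toNNReal
        {z | designReward (fun i => (φ (D i).1).ofLp) (fun i => (D i).2) z ∈ B} := by
  simp_rw [posteriorDistSq, posteriorScore_sampleOfDesign, posteriorCov_sampleOfDesign]
  exact priorNoise_mahalanobis_inter _ _ _ a hC (by simpa using (sq_pos_of_pos hσ).not_ge) m r hB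

end Posterior

/-! ### Joint measurability in data and parameter -/

section Measurability

variable {𝒳 : Type*} [MeasurableSpace 𝒳] {d K n : ℕ} {φ : 𝒳 → Vec d} (σ : ℝ) (m : Fin K → Vec d)
  (C : Fin K → Matrix (Fin d) (Fin d) ℝ)

theorem measurable_gramMatrix_apply (hφ : Measurable φ) (a : Fin K) (j k : Fin d) :
    Measurable fun s : Sample 𝒳 K n => gramMatrix φ σ s a j k := by
  have h : ∀ s : Sample 𝒳 K n, gramMatrix φ σ s a j k =
      (σ ^ 2)⁻¹ * ∑ i, if (s i).2.1 = a then φ (s i).1 j * φ (s i).1 k else 0 := by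
    intro s
    rw [gramMatrix, Matrix.smul_apply, Matrix.sum_apply, smul_eq_mul]
    congr 2
    ext i
    split_ifs <;> simp [Matrix.vecMulVec_apply]
  simp_rw [h]
  refine (Finset.measurable_sum _ fun i _ => Measurable.ite ?_ ?_ measurable_const).const_mul _
  · exact measurableSet_eq_fun (by fun_prop) measurable_const
  · fun_prop

theorem measurable_rewardVector_apply (hφ : Measurable φ) (a : Fin K) (k : Fin d) :
    Measurable fun s : Sample 𝒳 K n => rewardVector φ σ s a k := by
  have h : ∀ s : Sample 𝒳 K n, rewardVector φ σ s a k =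
      (σ ^ 2)⁻¹ * ∑ i, if (s i).2.1 = a then (s i).2.2 * φ (s i).1 k else 0 := by
    intro s
    rw [rewardVector, Pi.smul_apply, Finset.sum_apply, smul_eq_mul]
    congr 2
    ext i
    split_ifs <;> simp
  simp_rw [h]
  refine (Finset.measurable_sum _ fun i _ => Measurable.ite ?_ ?_ measurable_const).const_mul _
  · exact measurableSet_eq_fun (by fun_prop) measurable_const
  · fun_prop

theorem measurable_matrix_inv_apply {α ι : Type*} [MeasurableSpace α] [Fintype ι] [DecidableEq ι]
    {M : α → Matrix ι ι ℝ} (hM : ∀ j k, Measurable fun x => M x j k) (j k : ι) :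
    Measurable fun x => (M x)⁻¹ j k := by
  have hdet : ∀ {N : α → Matrix ι ι ℝ}, (∀ j k, Measurable fun x => N x j k) →
      Measurable fun x => (N x).det := by
    intro N hN
    simp_rw [Matrix.det_apply']
    exact Finset.measurable_sum _ fun p _ =>
      (Finset.measurable_prod _ fun i _ => hN _ _).const_mul _
  -- Cramer's rule makes each entry of the inverse a quotient of determinants, including the zero
  -- default for singular matrices.
  simp_rw [Matrix.inv_def, Matrix.smul_apply, Ring.inverse_eq_inv', Matrix.adjugate_apply,
    smul_eq_mul]
  refine (hdet hM).inv.mul (hdet fun p q => ?_)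
  by_cases hp : p = k
  · subst hp
    simp
  · simpa [Matrix.updateRow_ne hp] using hM p q

theorem measurable_posteriorDistSq (hφ : Measurable φ) (a : Fin K) :
    Measurable fun p : Sample 𝒳 K n × (Fin K → Vec d) => posteriorDistSq φ σ m C p.1 a p.2 := by
  have hprec : ∀ j k, Measurable fun p : Sample 𝒳 K n × (Fin K → Vec d) =>
      ((C a)⁻¹ + gramMatrix φ σ p.1 a) j k := fun j k =>
    ((measurable_gramMatrix_apply σ hφ a j k).comp measurable_fst).const_add _
  have hcov : ∀ j k, Measurable fun p : Sample 𝒳 K n × (Fin K → Vec d) =>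
      posteriorCov φ σ C p.1 a j k := fun j k => measurable_matrix_inv_apply hprec j k
  have hscore : ∀ k, Measurable fun p : Sample 𝒳 K n × (Fin K → Vec d) =>
      posteriorScore φ σ m C p.1 a p.2 k := by
    intro k
    simp only [posteriorScore, Pi.sub_apply, Pi.add_apply, Matrix.mulVec, dotProduct]
    refine (Finset.measurable_sum _ fun j _ => (hprec k j).mul (by fun_prop)).sub
      (((measurable_rewardVector_apply σ hφ a k).comp measurable_fst).const_add _)
  simp only [posteriorDistSq, Matrix.mulVec, dotProduct]
  exact Finset.measurable_sum _ fun j _ => (hscore j).mul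
    (Finset.measurable_sum _ fun k _ => (hcov j k).mul (hscore k))

theorem measurable_sampleOfDesign :
    Measurable fun p : (Fin n → 𝒳 × Fin K) × (Fin n → ℝ) => sampleOfDesign p.1 p.2 := by
  unfold sampleOfDesign
  fun_prop

end Measurability

/-! ### From a fixed design to the random data set -/

theorem map_add_pi_gaussianReal {n : ℕ} (v : NNReal) (b : Fin n → ℝ) :
    (Measure.pi fun _ : Fin n => gaussianReal 0 v).map (fun ε i => b i + ε i) =
      Measure.pi fun i => gaussianReal (b i) v := by
  have : ∀ i, SigmaFinite ((gaussianReal 0 v).map (b i + ·)) := fun i => by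
    rw [gaussianReal_map_const_add]
    infer_instance
  rw [Measure.pi_map_pi (f := fun i x => b i + x) fun i => by fun_prop]
  simp_rw [gaussianReal_map_const_add, zero_add]

namespace IsGaussianBandit

variable {Ω 𝒳 : Type*} [MeasurableSpace Ω] [MeasurableSpace 𝒳] {d K n : ℕ}
  {P : Measure Ω} [IsProbabilityMeasure P] {φ : 𝒳 → Vec d} {σ : ℝ}
  {m : Fin K → Vec d} {C : Fin K → Matrix (Fin d) (Fin d) ℝ}
  {θ : Fin K → Ω → Vec d} {X : Fin n → Ω → 𝒳} {A : Fin n → Ω → Fin K} {R : Fin n → Ω → ℝ}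

theorem measurable_params (h : IsGaussianBandit P φ σ m C θ X A R) :
    Measurable fun ω a => θ a ω := measurable_pi_lambda _ h.measurable_param

theorem measurable_design (h : IsGaussianBandit P φ σ m C θ X A R) :
    Measurable fun ω i => (X i ω, A i ω) :=
  measurable_pi_lambda _ fun i => (h.measurable_context i).prodMk (h.measurable_action i)

theorem measurable_rewards (h : IsGaussianBandit P φ σ m C θ X A R) :
    Measurable fun ω i => R i ω := measurable_pi_lambda _ h.measurable_reward

theorem measurable_sampleOf (h : IsGaussianBandit P φ σ m C θ X A R) :
    Measurable (sampleOf X A R) :=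
  measurable_pi_lambda _ fun i =>
    (h.measurable_context i).prodMk ((h.measurable_action i).prodMk (h.measurable_reward i))

theorem map_params_design (h : IsGaussianBandit P φ σ m C θ X A R) :
    P.map (fun ω => ((fun a => θ a ω), (fun i => (X i ω, A i ω)))) =
      (Measure.pi fun a => multivariateGaussian (m a) (C a)).prod
        (P.map fun ω i => (X i ω, A i ω)) := by
  rw [(indepFun_iff_map_prod_eq_prod_map_map h.measurable_params.aemeasurable
    h.measurable_design.aemeasurable).1 h.design_indep.symm,
    (iIndepFun_iff_map_fun_eq_pi_map fun a => (h.measurable_param a).aemeasurable).1 h.param_indep]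
  simp_rw [h.param_law]

/-- The model can be simulated by drawing the design, then independent parameters and noise, and
adding the noise to the mean rewards. This freezes the design so that the fixed-design results
apply. -/
theorem measure_params_design_rewards (h : IsGaussianBandit P φ σ m C θ X A R)
    {U : Set (((Fin K → Vec d) × (Fin n → 𝒳 × Fin K)) × (Fin n → ℝ))} (hU : MeasurableSet U) :
    P {ω | (((fun a => θ a ω), (fun i => (X i ω, A i ω))), fun i => R i ω) ∈ U} =
      ∫⁻ D, priorNoise n m C (σ ^ 2).toNNReal {z | ((z.1, D),
        designReward (fun i => (φ (D i).1).ofLp) (fun i => (D i).2) z) ∈ U}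
        ∂(P.map fun ω i => (X i ω, A i ω)) := by
  have hTD : Measurable fun ω => ((fun a => θ a ω), (fun i => (X i ω, A i ω))) :=
    h.measurable_params.prodMk h.measurable_design
  have : IsProbabilityMeasure (P.map fun ω i => (X i ω, A i ω)) :=
    Measure.isProbabilityMeasure_map h.measurable_design.aemeasurable
  have h1 : P {ω | (((fun a => θ a ω), (fun i => (X i ω, A i ω))), fun i => R i ω) ∈ U} =
      (P.map fun ω => (((fun a => θ a ω), (fun i => (X i ω, A i ω))), fun i => R i ω)) U := by
    rw [Measure.map_apply (hTD.prodMk h.measurable_rewards) hU]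
    rfl
  have hae := h.reward_law
  rw [h1, ← compProd_map_condDistrib h.measurable_rewards.aemeasurable,
    Measure.compProd_apply hU]
  have hmeas : AEMeasurable (fun z => condDistrib (fun ω i => R i ω)
      (fun ω => ((fun a => θ a ω), (fun i => (X i ω, A i ω)))) P z (Prod.mk z ⁻¹' U))
      (P.map fun ω => ((fun a => θ a ω), (fun i => (X i ω, A i ω)))) :=
    (Kernel.measurable_kernel_prodMk_left hU).aemeasurable
  have heq : (fun z => condDistrib (fun ω i => R i ω)
      (fun ω => ((fun a => θ a ω), (fun i => (X i ω, A i ω)))) P z (Prod.mk z ⁻¹' U))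
      =ᵐ[P.map fun ω => ((fun a => θ a ω), (fun i => (X i ω, A i ω)))]
      fun z => (Measure.pi fun i => gaussianReal (meanReward φ (z.2 i).1 (z.2 i).2 z.1)
        (σ ^ 2).toNNReal) (Prod.mk z ⁻¹' U) := by
    filter_upwards [hae] with z hz
    rw [hz]
  rw [lintegral_congr_ae heq]
  replace hmeas := hmeas.congr heq
  rw [h.map_params_design] at hmeas ⊢
  -- Independence of design and parameters allows the design to be integrated last.
  rw [lintegral_prod_symm _ hmeas]
  refine lintegral_congr fun D => ?_
  have hreward := measurable_designReward (d := d) (K := K)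
    (fun i => (φ (D i).1).ofLp) (fun i => (D i).2)
  rw [priorNoise, Measure.prod_apply (by
    exact ((measurable_fst.prodMk measurable_const).prodMk hreward) hU)]
  refine lintegral_congr fun ϑ => ?_
  rw [← map_add_pi_gaussianReal, Measure.map_apply (by fun_prop) (measurable_prodMk_left hU)]
  rfl

/-- The chi-square factor does not depend on the design, so it leaves the integral over designs. -/
theorem measure_posteriorDistSq_le_inter (h : IsGaussianBandit P φ σ m C θ X A R) (hσ : 0 < σ)
    (hC : ∀ b, (C b).PosDef) (a : Fin K) (r : ℝ) {B : Set (Sample 𝒳 K n)}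
    (hB : MeasurableSet B) :
    P {ω | posteriorDistSq φ σ m C (sampleOf X A R ω) a (fun b => θ b ω) ≤ r ∧
        sampleOf X A R ω ∈ B} =
      stdGaussian (Vec d) {x | ‖x‖ ^ 2 ≤ r} * P {ω | sampleOf X A R ω ∈ B} := by
  have hjoin : Measurable fun u : ((Fin K → Vec d) × (Fin n → 𝒳 × Fin K)) × (Fin n → ℝ) =>
      sampleOfDesign u.1.2 u.2 := measurable_sampleOfDesign.comp
        ((measurable_snd.comp measurable_fst).prodMk measurable_snd)
  have hdist : Measurable fun u : ((Fin K → Vec d) × (Fin n → 𝒳 × Fin K)) × (Fin n → ℝ) =>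
      posteriorDistSq φ σ m C (sampleOfDesign u.1.2 u.2) a u.1.1 :=
    Measurable.comp
      (g := fun p : Sample 𝒳 K n × (Fin K → Vec d) => posteriorDistSq φ σ m C p.1 a p.2)
      (f := fun u : ((Fin K → Vec d) × (Fin n → 𝒳 × Fin K)) × (Fin n → ℝ) =>
        (sampleOfDesign u.1.2 u.2, u.1.1))
      (measurable_posteriorDistSq σ m C h.measurable_feature a)
      (hjoin.prodMk (measurable_fst.comp measurable_fst))
  have hUB : P {ω | sampleOf X A R ω ∈ B} = ∫⁻ D, priorNoise n m C (σ ^ 2).toNNReal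
      {z | sampleOfDesign D
        (designReward (fun i => (φ (D i).1).ofLp) (fun i => (D i).2) z) ∈ B}
      ∂(P.map fun ω i => (X i ω, A i ω)) := h.measure_params_design_rewards (hjoin hB)
  have hUA : P {ω | posteriorDistSq φ σ m C (sampleOf X A R ω) a (fun b => θ b ω) ≤ r ∧
      sampleOf X A R ω ∈ B} = ∫⁻ D, priorNoise n m C (σ ^ 2).toNNReal
      {z | posteriorDistSq φ σ m C (sampleOfDesign D
          (designReward (fun i => (φ (D i).1).ofLp) (fun i => (D i).2) z)) a z.1 ≤ r ∧
        sampleOfDesign D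
          (designReward (fun i => (φ (D i).1).ofLp) (fun i => (D i).2) z) ∈ B}
      ∂(P.map fun ω i => (X i ω, A i ω)) := h.measure_params_design_rewards
    ((measurableSet_le hdist (measurable_const (a := r))).inter (hjoin hB))
  rw [hUA, hUB, ← lintegral_const_mul' _ _ (measure_ne_top _ _)]
  refine lintegral_congr fun D => ?_
  have hBD : MeasurableSet {r : Fin n → ℝ | sampleOfDesign D r ∈ B} :=
    (measurable_sampleOfDesign.comp measurable_prodMk_left) hB
  exact priorNoise_posteriorDistSq_inter φ σ m hσ hC D a r hBD

theorem ae_le_condDistrib_posteriorDistSq_le (h : IsGaussianBandit P φ σ m C θ X A R)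
    (hσ : 0 < σ) (hC : ∀ b, (C b).PosDef) (a : Fin K) (r : ℝ) :
    ∀ᵐ s ∂(P.map (sampleOf X A R)), stdGaussian (Vec d) {x | ‖x‖ ^ 2 ≤ r} ≤
      condDistrib (fun ω b => θ b ω) (sampleOf X A R) P s
        {ϑ | posteriorDistSq φ σ m C s a ϑ ≤ r} := by
  have hS := h.measurable_sampleOf
  have hE : MeasurableSet {p : Sample 𝒳 K n × (Fin K → Vec d) |
      posteriorDistSq φ σ m C p.1 a p.2 ≤ r} :=
    measurableSet_le (measurable_posteriorDistSq σ m C h.measurable_feature a) measurable_const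
  have : IsProbabilityMeasure (P.map (sampleOf X A R)) :=
    Measure.isProbabilityMeasure_map hS.aemeasurable
  -- The almost sure inequality is tested by integrating over measurable sets `B` of data, where the
  -- disintegration turns each integral into the joint probability with `S ∈ B`.
  refine ae_le_of_forall_setLIntegral_le_of_sigmaFinite measurable_const fun B hB _ => ?_
  have hint := Measure.setLIntegral_compProd (μ := P.map (sampleOf X A R))
    (κ := condDistrib (fun ω b => θ b ω) (sampleOf X A R) P)
    (measurable_one.indicator hE) hB MeasurableSet.univ
  rw [lintegral_indicator_one hE, Measure.restrict_apply hE,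
    compProd_map_condDistrib h.measurable_params.aemeasurable,
    Measure.map_apply (hS.prodMk h.measurable_params) (hE.inter (hB.prod MeasurableSet.univ))]
    at hint
  have hval : P {ω | posteriorDistSq φ σ m C (sampleOf X A R ω) a (fun b => θ b ω) ≤ r ∧
      sampleOf X A R ω ∈ B} = ∫⁻ s in B, condDistrib (fun ω b => θ b ω) (sampleOf X A R) P s
        {ϑ | posteriorDistSq φ σ m C s a ϑ ≤ r} ∂(P.map (sampleOf X A R)) := by
    refine Eq.trans ?_ (hint.trans (lintegral_congr fun s => ?_))
    · congr 1
      ext ω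
      simp
    · rw [Measure.restrict_univ]
      exact lintegral_indicator_one (measurable_prodMk_left hE)
  rw [← hval, h.measure_posteriorDistSq_le_inter hσ hC a r hB, setLIntegral_const,
    Measure.map_apply hS hB]
  rfl

end IsGaussianBandit

theorem mainTheorem6 {Ω 𝒳 : Type*} [MeasurableSpace Ω] [MeasurableSpace 𝒳] {d K n : ℕ}
    (P : Measure Ω) [IsProbabilityMeasure P] (φ : 𝒳 → Vec d) (σ : ℝ) (hσ : 0 < σ)
    (m : Fin K → Vec d) (C : Fin K → Matrix (Fin d) (Fin d) ℝ) (hC : ∀ a, (C a).PosDef)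
    (θ : Fin K → Ω → Vec d) (X : Fin n → Ω → 𝒳) (A : Fin n → Ω → Fin K) (R : Fin n → Ω → ℝ)
    (hmodel : IsGaussianBandit P φ σ m C θ X A R)
    (a : Fin K) (δ : ℝ) (hδ : δ ∈ Set.Ioo (0 : ℝ) 1) :
    ∀ᵐ s ∂(P.map (sampleOf X A R)),
      1 - δ ≤ (condDistrib (fun ω b => θ b ω) (sampleOf X A R) P s).real
        {ϑ : Fin K → Vec d | ∀ x : 𝒳,
          |meanReward φ x a ϑ - meanReward φ x a (posteriorMean φ σ m C s)| ≤
            confidenceRadius d δ * weightedNorm (posteriorCov φ σ C s a) (φ x)} := by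
  filter_upwards [hmodel.ae_le_condDistrib_posteriorDistSq_le hσ hC a (confidenceRadius d δ ^ 2)]
    with s hs
  refine (stdGaussian_real_norm_sq_le_ge (d := d) hδ).trans
    ((ENNReal.toReal_mono (measure_ne_top _ _) hs).trans (measureReal_mono ?_))
  -- Only monotonicity of the measure is used here, so the event over all `x`, possibly an
  -- uncountable intersection, need not be shown measurable.
  exact fun ϑ hϑ x => abs_meanReward_sub_le φ σ m s a (hC a) hϑ x
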